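/- Let $\mathcal H$ be a real Hilbert space, let $f\colon\mathcal H\to\,]-\infty,+\infty]$ be proper, lower semicontinuous and convex, let $\mu\in\,]0,+\infty[$, and let $h\colon\mathcal H\to\mathbb R$ be convex and differentiable with $\mu$-Lipschitz continuous gradient. Let $$\partial f(x)=\{u\in\mathcal H : \langle y-x, u\rangle+f(x)\le f(y)\ \text{for all } y\in\mathcal H\}$$ be the subdifferential of $f$, let $\operatorname{zer}(\partial f+\nabla h)=\{x\in\mathcal H : 0\in\partial f(x)+\nabla h(x)\}$, and assume that $\operatorname{zer}(\partial f+\nabla h)\neq\varnothing$. Let $\gamma\in\,]0,0.5/\mu[$, let $x_{-1},x_0\in\mathcal H$ be arbitrary, and iterate, for every $n\in\mathbb N=\{0,1,2,\dots\}$, $$y_n=2x_n-x_{n-1},\qquad x_{n+1}=\operatorname{prox}_{\gamma f}\bigl(x_n-\gamma\nabla h(y_n)\bigr),$$ where $\operatorname{prox}_{\gamma f}(x)$ is the minimizer of $y\mapsto \gamma f(y)+\tfrac12\|x-y\|^2$ over $\mathcal H$. Then there is a point $\overline{x}\in\operatorname{zer}(\partial f+\nabla h)$ such that $(x_n)_{n\in\mathbb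 N}$ converges weakly to $\overline{x}$, and $\overline{x}$ minimizes $f+h$ over $\mathcal H$. -/

import Mathlib

open Filter Topology
open scoped NNReal Pointwise Gradient

namespace ReflectedFB

/-- The class `Γ₀(H)`: proper, lower semicontinuous, convex functions `H → ]-∞, +∞]`.
Convexity of an extended-real-valued function means convexity of its epigraph. -/
structure IsGamma0 {H : Type*} [NormedAddCommGroup H] [InnerProductSpace ℝ H]
    (f : H → EReal) : Prop where
  ne_bot : ∀ x, f x ≠ ⊥
  exists_ne_top : ∃ x, f x ≠ ⊤
  lowerSemicontinuous : LowerSemicontinuous f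
  convex_epigraph : Convex ℝ {p : H × ℝ | f p.1 ≤ (p.2 : EReal)}

/-- The subdifferential `∂f x = {u | ∀ y, ⟪y - x, u⟫ + f x ≤ f y}`. -/
def subdifferential {H : Type*} [NormedAddCommGroup H] [InnerProductSpace ℝ H]
    (f : H → EReal) (x : H) : Set H :=
  {u | ∀ y, ((inner ℝ (y - x) u : ℝ) : EReal) + f x ≤ f y}

/-- The zero set of a set-valued operator `A : H → 2^H`. -/
def zer {H : Type*} [Zero H] (A : H → Set H) : Set H :=
  {x | (0 : H) ∈ A x}

/-- The proximity operator `prox_f x = argmin_y f y + ½ ‖x - y‖²`. The minimizer exists and is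
unique when `f` is in `Γ₀(H)` and `H` is complete. -/
noncomputable def prox {H : Type*} [NormedAddCommGroup H] [InnerProductSpace ℝ H]
    (f : H → EReal) (x : H) : H :=
  Classical.epsilon fun p : H =>
    IsMinOn (fun y : H => f y + ((1 / 2 * ‖x - y‖ ^ 2 : ℝ) : EReal)) Set.univ p

end ReflectedFB

/-! Write `d n` for the increment x_n - x_{n-1}, so that y_n = x_n + d_n. For each zero s, the
energy ‖x_n - s‖² + γμ‖d_n‖² drops by at least (1 - 2γμ)‖d_{n+1}‖² at each step, and γ < 1/(2μ)
makes this factor positive. The drop (`reflected_step_estimate`) combines monotonicity of ∂f at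
x_{n+1} and s with cocoercivity of ∇h at y_n and s (`cocoercive_gradient`).

Hence the energies converge and d_n → 0, so ‖x_n - s‖² converges for every zero s. Moreover f + h
has subgradients at x_{n+1} tending to 0. As its sublevel sets are closed and convex, hence weakly
closed, every weak cluster point minimizes f + h (`isMinOn_of_tendsto_subgradient`) and is a zero by
Fermat's rule. Opial's lemma concludes. -/

namespace ReflectedFB

/-! ### Convex functions with Lipschitz gradient -/

section Gradient

variable {H : Type*} [NormedAddCommGroup H] [InnerProductSpace ℝ H] [CompleteSpace H]

/-- The derivative of a function along a line, in terms of its gradient. -/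
lemma hasDerivAt_comp_line {h : H → ℝ} {x d g : H} {t : ℝ} (hg : HasGradientAt h g (x + t • d)) :
    HasDerivAt (fun s : ℝ => h (x + s • d)) (inner ℝ g d) t := by
  have h1 : HasDerivAt (fun s : ℝ => x + s • d) d t := by
    simpa using ((hasDerivAt_id t).smul_const d).const_add x
  exact hg.hasFDerivAt.comp_hasDerivAt t h1

/-- A differentiable convex function lies above its tangent hyperplanes. -/
lemma _root_.ConvexOn.add_inner_gradient_le {h : H → ℝ} (hc : ConvexOn ℝ Set.univ h) {x g : H}
    (hg : HasGradientAt h g x) (y : H) : h x + inner ℝ g (y - x) ≤ h y := by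
  have hline : ConvexOn ℝ Set.univ (fun s : ℝ => h (x + s • (y - x))) := by
    have h1 : (fun s : ℝ => h (x + s • (y - x))) = h ∘ AffineMap.lineMap (k := ℝ) x y := by
      ext s
      simp [AffineMap.lineMap_apply, add_comm]
    rw [h1]
    exact hc.comp_affineMap (AffineMap.lineMap (k := ℝ) x y)
  have hd := hasDerivAt_comp_line (x := x) (d := y - x) (t := 0) (h := h) (g := g) (by simpa using hg)
  have := hline.le_slope_of_hasDerivAt (Set.mem_univ 0) (Set.mem_univ 1) zero_lt_one hd
  simp [slope] at this
  linarith

/-- The descent lemma: a function with `μ`-Lipschitz gradient lies below its quadratic models. -/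
lemma le_quadratic_of_lipschitz_gradient {h : H → ℝ} (hd : Differentiable ℝ h) {μ : ℝ≥0}
    (hl : LipschitzWith μ (∇ h)) (x d : H) :
    h (x + d) ≤ h x + inner ℝ (∇ h x) d + μ / 2 * ‖d‖ ^ 2 := by
  -- Along the segment, `h` minus its quadratic model has nonpositive derivative; compare s = 0 and
  -- s = 1.
  have hder : ∀ t : ℝ, HasDerivAt
      (fun s : ℝ => h (x + s • d) - s * inner ℝ (∇ h x) d - μ / 2 * ‖d‖ ^ 2 * s ^ 2)
      (inner ℝ (∇ h (x + t • d)) d - inner ℝ (∇ h x) d - μ / 2 * ‖d‖ ^ 2 * (2 * t)) t := by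
    intro t
    refine ((hasDerivAt_comp_line (hd _).hasGradientAt).sub ?_).sub ?_
    · simpa using (hasDerivAt_id t).mul_const (inner ℝ (∇ h x) d)
    · simpa using (hasDerivAt_pow 2 t).const_mul (μ / 2 * ‖d‖ ^ 2)
  have hanti := antitoneOn_of_deriv_nonpos (convex_Icc (0 : ℝ) 1)
    (fun t _ => (hder t).continuousAt.continuousWithinAt)
    (fun t _ => (hder t).differentiableAt.differentiableWithinAt) (fun t ht => by
      rw [interior_Icc] at ht
      rw [(hder t).deriv, ← inner_sub_left]
      have h1 := real_inner_le_norm (∇ h (x + t • d) - ∇ h x) d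
      have h2 : ‖∇ h (x + t • d) - ∇ h x‖ ≤ μ * (t * ‖d‖) := by
        simpa [dist_eq_norm, norm_smul, abs_of_pos ht.1] using hl.dist_le_mul (x + t • d) x
      nlinarith [mul_le_mul_of_nonneg_right h2 (norm_nonneg d)])
  have := hanti (Set.left_mem_Icc.2 zero_le_one) (Set.right_mem_Icc.2 zero_le_one) zero_le_one
  simp [-inner_gradient_left] at this
  linarith

/-- The improved gradient inequality of a convex function with `μ`-Lipschitz gradient. -/
lemma add_inner_gradient_add_sq_le {h : H → ℝ} (hc : ConvexOn ℝ Set.univ h)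
    (hd : Differentiable ℝ h) {μ : ℝ≥0} (hμ : 0 < μ) (hl : LipschitzWith μ (∇ h)) (x y : H) :
    h x + inner ℝ (∇ h x) (y - x) + 1 / (2 * μ) * ‖∇ h y - ∇ h x‖ ^ 2 ≤ h y := by
  have hμ' : (0 : ℝ) < μ := hμ
  set g := ∇ h y - ∇ h x with hg
  -- This displacement minimizes the quadratic model at `y` of `h` minus its tangent at `x`.
  have h1 := le_quadratic_of_lipschitz_gradient hd hl y (-(μ : ℝ)⁻¹ • g)
  have h2 := hc.add_inner_gradient_le (hd x).hasGradientAt (y + -(μ : ℝ)⁻¹ • g)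
  rw [show y + -(μ : ℝ)⁻¹ • g - x = (y - x) + -(μ : ℝ)⁻¹ • g by abel, inner_add_right] at h2
  rw [inner_smul_right] at h1 h2
  have h3 : inner ℝ (∇ h y) g - inner ℝ (∇ h x) g = ‖g‖ ^ 2 := by
    rw [← inner_sub_left, ← hg, real_inner_self_eq_norm_sq]
  have h4 : (μ : ℝ) / 2 * ‖-(μ : ℝ)⁻¹ • g‖ ^ 2 = 1 / (2 * μ) * ‖g‖ ^ 2 := by
    rw [norm_smul, norm_neg, norm_inv, Real.norm_of_nonneg hμ'.le]
    field_simp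
  have h5 : (μ : ℝ)⁻¹ * ‖g‖ ^ 2 = 2 * (1 / (2 * μ) * ‖g‖ ^ 2) := by field_simp
  have h6 : (μ : ℝ)⁻¹ * ‖g‖ ^ 2 = (μ : ℝ)⁻¹ * inner ℝ (∇ h y) g - (μ : ℝ)⁻¹ * inner ℝ (∇ h x) g := by
    rw [← h3, mul_sub]
  linarith

/-- The Baillon–Haddad theorem: the `μ`-Lipschitz gradient of a convex function is
`1 / μ`-cocoercive. -/
theorem cocoercive_gradient {h : H → ℝ} (hc : ConvexOn ℝ Set.univ h)
    (hd : Differentiable ℝ h) {μ : ℝ≥0} (hμ : 0 < μ) (hl : LipschitzWith μ (∇ h)) (x y : H) :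
    ‖∇ h x - ∇ h y‖ ^ 2 ≤ μ * inner ℝ (∇ h x - ∇ h y) (x - y) := by
  have hμ' : (0 : ℝ) < μ := hμ
  have h1 := add_inner_gradient_add_sq_le hc hd hμ hl x y
  have h2 := add_inner_gradient_add_sq_le hc hd hμ hl y x
  rw [norm_sub_rev (∇ h y)] at h1
  rw [← neg_sub x y, inner_neg_right] at h1
  have h3 : 2 * (1 / (2 * μ) * ‖∇ h x - ∇ h y‖ ^ 2) ≤ inner ℝ (∇ h x - ∇ h y) (x - y) := by
    rw [inner_sub_left]; linarith
  calc ‖∇ h x - ∇ h y‖ ^ 2 = μ * (2 * (1 / (2 * μ) * ‖∇ h x - ∇ h y‖ ^ 2)) := by field_simp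
    _ ≤ _ := by gcongr

end Gradient

/-! ### Weak compactness and Opial's lemma -/

section WeakConvergence

variable {H : Type*} [NormedAddCommGroup H] [InnerProductSpace ℝ H]

/-- Weak convergence in a Hilbert space is convergence of inner products. -/
lemma tendsto_toWeakSpace_iff [CompleteSpace H] {ι : Type*} {l : Filter ι} {x : ι → H} {p : H} :
    Tendsto (fun n => toWeakSpace ℝ H (x n)) l (𝓝 (toWeakSpace ℝ H p)) ↔
      ∀ z : H, Tendsto (fun n => inner ℝ z (x n)) l (𝓝 (inner ℝ z p)) := by
  have hinj : Function.Injective (topDualPairing ℝ H).flip := by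
    intro a b hab
    refine ext_inner_left ℝ fun v => ?_
    exact DFunLike.congr_fun hab (innerSL ℝ v)
  refine (WeakBilin.tendsto_iff_forall_eval_tendsto _ hinj).trans ?_
  refine (InnerProductSpace.toDual ℝ H).toEquiv.forall_congr_right.symm.trans ?_
  rfl

/-- Weak limits of a sequence in a closed convex set stay in the set. -/
lemma mem_of_tendsto_toWeakSpace {ι : Type*} {l : Filter ι} [l.NeBot] {x : ι → H} {p : H}
    (hx : Tendsto (fun n => toWeakSpace ℝ H (x n)) l (𝓝 (toWeakSpace ℝ H p)))
    {C : Set H} (hC : IsClosed C) (hconv : Convex ℝ C) (hmem : ∀ᶠ n in l, x n ∈ C) : p ∈ C := by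
  have h1 := hconv.toWeakSpace_closure ℝ
  rw [hC.closure_eq] at h1
  have h2 : toWeakSpace ℝ H p ∈ closure (toWeakSpace ℝ H '' C) :=
    mem_closure_of_tendsto hx (hmem.mono fun n hn => Set.mem_image_of_mem _ hn)
  rw [← h1] at h2
  obtain ⟨q, hq, hqp⟩ := h2
  exact (toWeakSpace ℝ H).injective hqp ▸ hq

/-- A bounded family in a Hilbert space has a weak limit along every ultrafilter. -/
lemma exists_tendsto_toWeakSpace [CompleteSpace H] {ι : Type*} (U : Ultrafilter ι) {x : ι → H}
    {R : ℝ} (hx : ∀ᶠ n in U, ‖x n‖ ≤ R) :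
    ∃ p : H, Tendsto (fun n => toWeakSpace ℝ H (x n)) U (𝓝 (toWeakSpace ℝ H p)) := by
  -- The Riesz map carries the family into the dual, where Banach–Alaoglu applies.
  let J : H → WeakDual ℝ H := fun v => StrongDual.toWeakDual (InnerProductSpace.toDual ℝ H v)
  have hcpt := WeakDual.isCompact_closedBall (𝕜 := ℝ) (E := H) 0 R
  have hmem : ∀ᶠ n in U, J (x n) ∈ WeakDual.toStrongDual ⁻¹' Metric.closedBall 0 R := by
    filter_upwards [hx] with n hn
    simpa [J] using hn
  obtain ⟨φ, -, hφ⟩ := hcpt.ultrafilter_le_nhds (U.map (J ∘ x)) (le_principal_iff.2 hmem)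
  refine ⟨(InnerProductSpace.toDual ℝ H).symm (WeakDual.toStrongDual φ),
    tendsto_toWeakSpace_iff.2 fun z => ?_⟩
  have h1 : Tendsto (fun n => J (x n) z) U (𝓝 (φ z)) :=
    ((WeakDual.eval_continuous z).tendsto φ).comp (show Tendsto (J ∘ x) U (𝓝 φ) from hφ)
  have h2 : ∀ n, J (x n) z = inner ℝ z (x n) := fun n => by
    rw [real_inner_comm]; rfl
  simp only [h2] at h1
  rw [real_inner_comm, InnerProductSpace.toDual_symm_apply]
  exact h1

/-- Opial's lemma: a sequence converges weakly to a point of `S` as soon as its distance to every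
point of `S` converges and `S` contains all its weak limits along ultrafilters. -/
theorem exists_tendsto_toWeakSpace_of_opial [CompleteSpace H] {x : ℕ → H} {S : Set H}
    (hS : S.Nonempty) (hdist : ∀ s ∈ S, ∃ c : ℝ, Tendsto (fun n => ‖x n - s‖ ^ 2) atTop (𝓝 c))
    (hlim : ∀ U : Ultrafilter ℕ, ↑U ≤ (atTop : Filter ℕ) → ∀ p : H,
      Tendsto (fun n => toWeakSpace ℝ H (x n)) U (𝓝 (toWeakSpace ℝ H p)) → p ∈ S) :
    ∃ p ∈ S, Tendsto (fun n => toWeakSpace ℝ H (x n)) atTop (𝓝 (toWeakSpace ℝ H p)) := by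
  obtain ⟨s, hs⟩ := hS
  obtain ⟨c, hc⟩ := hdist s hs
  have hbdd : ∀ᶠ n in atTop, ‖x n‖ ≤ (c + 1 + 1) + ‖s‖ := by
    filter_upwards [hc.eventually (gt_mem_nhds (lt_add_one c))] with n hn
    have h1 : ‖x n‖ ≤ ‖x n - s‖ + ‖s‖ := by simpa using norm_add_le (x n - s) s
    nlinarith [sq_nonneg (‖x n - s‖ - 1)]
  have hex : ∀ U : Ultrafilter ℕ, ↑U ≤ (atTop : Filter ℕ) → ∃ p ∈ S,
      Tendsto (fun n => toWeakSpace ℝ H (x n)) U (𝓝 (toWeakSpace ℝ H p)) := fun U hU => by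
    obtain ⟨p, hp⟩ := exists_tendsto_toWeakSpace U (hU hbdd)
    exact ⟨p, hlim U hU p hp, hp⟩
  obtain ⟨U, hU⟩ := Ultrafilter.exists_le (atTop : Filter ℕ)
  obtain ⟨p, hpS, hp⟩ := hex U hU
  refine ⟨p, hpS, (tendsto_iff_ultrafilter _ _ _).2 fun V hV => ?_⟩
  obtain ⟨q, hqS, hq⟩ := hex V hV
  obtain ⟨a, ha⟩ := hdist p hpS
  obtain ⟨b, hb⟩ := hdist q hqS
  -- Up to a constant, this inner product is half the difference of the squared distances to `q` and
  -- `p`. It converges along the whole sequence, so both weak limits give it the same value.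
  have hconv : Tendsto (fun n => inner ℝ (p - q) (x n)) atTop
      (𝓝 ((b - a + (‖p‖ ^ 2 - ‖q‖ ^ 2)) / 2)) := by
    refine (((hb.sub ha).add_const (‖p‖ ^ 2 - ‖q‖ ^ 2)).div_const 2).congr fun n => ?_
    rw [norm_sub_sq_real, norm_sub_sq_real, inner_sub_left, real_inner_comm p, real_inner_comm q]
    ring
  have h1 := tendsto_nhds_unique (hconv.mono_left hU) (tendsto_toWeakSpace_iff.1 hp (p - q))
  have h2 := tendsto_nhds_unique (hconv.mono_left hV) (tendsto_toWeakSpace_iff.1 hq (p - q))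
  have h3 : inner ℝ (p - q) (p - q) = (0 : ℝ) := by
    rw [inner_sub_right, ← h1, ← h2, sub_self]
  have h4 : p = q := sub_eq_zero.1 (inner_self_eq_zero.1 h3)
  exact h4 ▸ hq

end WeakConvergence

/-! ### Minimizers, subdifferentials and the proximity operator -/

section Minimizers

/-- Turns a sublevel set of f + q into the preimage of the epigraph of f under z ↦ (z, c - q z). -/
lemma _root_.EReal.add_coe_le_coe_iff {a : EReal} {b c : ℝ} :
    a + (b : EReal) ≤ (c : EReal) ↔ a ≤ ((c - b : ℝ) : EReal) := by
  induction a with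
  | bot => simp
  | coe a => norm_cast; exact le_sub_iff_add_le.symm
  | top => simp only [EReal.top_add_coe, top_le_iff, EReal.coe_ne_top]

variable {H : Type*} [NormedAddCommGroup H] [InnerProductSpace ℝ H] {f : H → EReal}

/-- A convexity inequality for extended-real-valued functions, read off the epigraph. -/
lemma IsGamma0.le_combo (hf : IsGamma0 f) {u v : H} {r s a b : ℝ} (hu : f u ≤ r) (hv : f v ≤ s)
    (ha : 0 ≤ a) (hb : 0 ≤ b) (hab : a + b = 1) :
    f (a • u + b • v) ≤ ((a * r + b * s : ℝ) : EReal) :=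
  hf.convex_epigraph (x := (u, r)) hu (y := (v, s)) hv ha hb hab

lemma IsGamma0.isClosed_epigraph (hf : IsGamma0 f) :
    IsClosed {p : H × ℝ | f p.1 ≤ (p.2 : EReal)} := by
  have h1 := lowerSemicontinuous_iff_isClosed_epigraph.1 hf.lowerSemicontinuous
  exact h1.preimage (f := fun p : H × ℝ => (p.1, (p.2 : EReal)))
    (continuous_fst.prodMk (continuous_coe_real_ereal.comp continuous_snd))

/-- The class `Γ₀` is stable under multiplication by positive reals. -/
lemma IsGamma0.const_mul (hf : IsGamma0 f) {c : ℝ} (hc : 0 < c) :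
    IsGamma0 fun z => (c : EReal) * f z := by
  have key : ∀ z (r : ℝ), (c : EReal) * f z ≤ r ↔ f z ≤ ((c⁻¹ * r : ℝ) : EReal) := fun z r => by
    induction f z with
    | bot => simp [EReal.coe_mul_bot_of_pos hc]
    | coe a => norm_cast; exact (le_inv_mul_iff₀ hc).symm
    | top => simp only [EReal.coe_mul_top_of_pos hc, top_le_iff, EReal.coe_ne_top]
  refine ⟨fun z => ?_, ?_, ?_, ?_⟩
  · have := hf.ne_bot z
    induction hz : f z with
    | bot => exact absurd hz this
    | coe a => exact_mod_cast EReal.coe_ne_bot (c * a)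
    | top => simp [EReal.coe_mul_top_of_pos hc]
  · obtain ⟨z, hz⟩ := hf.exists_ne_top
    refine ⟨z, ?_⟩
    induction h : f z with
    | bot => simp [EReal.coe_mul_bot_of_pos hc]
    | coe a => exact_mod_cast EReal.coe_ne_top (c * a)
    | top => exact absurd h hz
  · intro z t ht
    obtain ⟨r, htr, hr⟩ := EReal.lt_iff_exists_real_btwn.1 ht
    have h1 : ((c⁻¹ * r : ℝ) : EReal) < f z := not_le.1 fun h => not_le.2 hr ((key z r).2 h)
    filter_upwards [hf.lowerSemicontinuous z _ h1] with w hw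
    exact htr.trans (not_le.1 fun h => not_le.2 hw ((key w r).1 h))
  · intro p hp q hq a b ha hb hab
    simp only [Set.mem_ofPred_eq, key] at hp hq ⊢
    refine (hf.le_combo hp hq ha hb hab).trans_eq (congrArg _ ?_)
    change a * (c⁻¹ * p.2) + b * (c⁻¹ * q.2) = c⁻¹ * (a * p.2 + b * q.2)
    ring

lemma IsGamma0.isClosed_sublevel (hf : IsGamma0 f) {q : H → ℝ} (hq : Continuous q) (c : ℝ) :
    IsClosed {z | f z + (q z : EReal) ≤ (c : EReal)} := by
  simp only [EReal.add_coe_le_coe_iff]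
  exact hf.isClosed_epigraph.preimage (f := fun z => (z, c - q z)) (by fun_prop)

lemma IsGamma0.convex_sublevel (hf : IsGamma0 f) {q : H → ℝ} (hq : ConvexOn ℝ Set.univ q) (c : ℝ) :
    Convex ℝ {z | f z + (q z : EReal) ≤ (c : EReal)} := by
  simp only [EReal.add_coe_le_coe_iff]
  intro u hu v hv a b ha hb hab
  refine (hf.le_combo hu hv ha hb hab).trans (EReal.coe_le_coe_iff.2 ?_)
  have h1 := hq.2 (Set.mem_univ u) (Set.mem_univ v) ha hb hab
  simp only [smul_eq_mul] at h1
  have h2 : c = a * c + b * c := by rw [← add_mul, hab, one_mul]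
  linarith

/-- A function `f + q`, with `f` in `Γ₀` and `q` real-valued, continuous and convex, has a minimizer
when its sublevel sets are bounded. -/
theorem IsGamma0.exists_isMinOn [CompleteSpace H] (hf : IsGamma0 f) {q : H → ℝ}
    (hqc : Continuous q) (hq : ConvexOn ℝ Set.univ q)
    (hbdd : ∀ c : ℝ, ∃ R : ℝ, ∀ z, f z + (q z : EReal) ≤ (c : EReal) → ‖z‖ ≤ R) :
    ∃ p, IsMinOn (fun z => f z + (q z : EReal)) Set.univ p := by
  set φ : H → EReal := fun z => f z + (q z : EReal) with hφ
  obtain ⟨z₀, hz₀⟩ := hf.exists_ne_top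
  have hφz₀ : φ z₀ < ⊤ := EReal.add_lt_top hz₀ (EReal.coe_ne_top _)
  have hm : ⨅ z, φ z < ⊤ := (iInf_le φ z₀).trans_lt hφz₀
  obtain ⟨u, -, hlim, hu⟩ :=
    exists_seq_tendsto_sInf (S := Set.range φ) ⟨_, z₀, rfl⟩ (OrderBot.bddBelow _)
  choose x hx using hu
  obtain ⟨U, hU⟩ := Ultrafilter.exists_le (atTop : Filter ℕ)
  have hev : ∀ c : ℝ, ⨅ z, φ z < (c : EReal) → ∀ᶠ n in U, φ (x n) ≤ c := fun c hc =>
    hU ((hlim.eventually (gt_mem_nhds hc)).mono fun n hn => (hx n).trans_le hn.le)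
  obtain ⟨c, hc, -⟩ := EReal.lt_iff_exists_real_btwn.1 hm
  obtain ⟨R, hR⟩ := hbdd c
  obtain ⟨p, hp⟩ := exists_tendsto_toWeakSpace U ((hev c hc).mono fun n hn => hR _ hn)
  refine ⟨p, fun z _ => le_trans ?_ (iInf_le φ z)⟩
  -- Every sublevel set strictly above the infimum eventually contains `x n` along `U`, hence
  -- contains `p`.
  refine EReal.le_of_forall_lt_iff_le.1 fun d hd => ?_
  exact mem_of_tendsto_toWeakSpace hp (hf.isClosed_sublevel hqc d) (hf.convex_sublevel hq d)
    (hev d hd)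

/-- The zeros of `∂f + g`, for a single-valued operator `g`. -/
lemma mem_zer_add_singleton {g : H → H} {z : H} :
    (z ∈ zer fun z : H => subdifferential f z + {g z}) ↔ -g z ∈ subdifferential f z := by
  simp [zer]

/-- A function with a subgradient at `z` is finite at `z`. -/
lemma IsGamma0.ne_top_of_mem_subdifferential (hf : IsGamma0 f) {z u : H}
    (hu : u ∈ subdifferential f z) : f z ≠ ⊤ := fun htop => by
  obtain ⟨w, hw⟩ := hf.exists_ne_top
  have := hu w
  rw [htop, EReal.coe_add_top, top_le_iff] at this
  exact hw this

/-- The subdifferential of a function in `Γ₀` is a monotone operator. -/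
lemma IsGamma0.subdifferential_monotone (hf : IsGamma0 f) {z w u v : H}
    (hu : u ∈ subdifferential f z) (hv : v ∈ subdifferential f w) :
    0 ≤ inner ℝ (u - v) (z - w) := by
  have h1 := hu w
  have h2 := hv z
  lift f z to ℝ using ⟨hf.ne_top_of_mem_subdifferential hu, hf.ne_bot z⟩ with a
  lift f w to ℝ using ⟨hf.ne_top_of_mem_subdifferential hv, hf.ne_bot w⟩ with b
  norm_cast at h1 h2
  rw [real_inner_comm, inner_sub_right]
  rw [← neg_sub z w, inner_neg_left] at h1
  linarith

/-- Fermat's rule for `f + q`, with `f` in `Γ₀` and `q` differentiable at the minimizer. -/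
theorem IsGamma0.neg_gradient_mem_subdifferential [CompleteSpace H] (hf : IsGamma0 f) {q : H → ℝ}
    {p g : H} (hg : HasGradientAt q g p)
    (hmin : IsMinOn (fun z => f z + (q z : EReal)) Set.univ p) : -g ∈ subdifferential f p := by
  have hmin' : ∀ z, f p + (q p : EReal) ≤ f z + (q z : EReal) := fun z => hmin (Set.mem_univ z)
  have hp : f p ≠ ⊤ := fun htop => by
    obtain ⟨w, hw⟩ := hf.exists_ne_top
    have := hmin' w
    rw [htop, EReal.top_add_coe, top_le_iff] at this
    exact (EReal.add_lt_top hw (EReal.coe_ne_top _)).ne this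
  intro y
  by_cases hy : f y = ⊤
  · simp [hy]
  obtain ⟨a, ha⟩ : ∃ a : ℝ, f p = a := ⟨_, (EReal.coe_toReal hp (hf.ne_bot p)).symm⟩
  obtain ⟨b, hb⟩ : ∃ b : ℝ, f y = b := ⟨_, (EReal.coe_toReal hy (hf.ne_bot y)).symm⟩
  have hder := hasDerivAt_comp_line (x := p) (d := y - p) (t := 0) (h := q) (g := g)
    (by simpa using hg)
  have hslope := hder.tendsto_slope_zero_right
  -- By minimality and convexity of f on the segment, each difference quotient of `q` at `p` is at
  -- least `a - b`.
  have hle : a - b ≤ inner ℝ g (y - p) := by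
    refine ge_of_tendsto hslope ?_
    filter_upwards [Ioo_mem_nhdsGT (zero_lt_one (α := ℝ))] with t ht
    have h1 := hf.le_combo ha.le hb.le (sub_nonneg.2 ht.2.le) ht.1.le (sub_add_cancel 1 t)
    have h2 := (hmin' ((1 - t) • p + t • y)).trans (add_le_add_left h1 _)
    rw [ha] at h2
    norm_cast at h2
    rw [show (1 - t) • p + t • y = p + t • (y - p) by module] at h2
    simp only [zero_add, zero_smul, add_zero, smul_eq_mul]
    rw [← div_eq_inv_mul, le_div_iff₀ ht.1]
    linarith
  rw [ha, hb]
  norm_cast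
  rw [inner_neg_right, real_inner_comm]
  linarith

/-- The proximity operator of a subdifferentiable function is the resolvent of its
subdifferential. -/
theorem IsGamma0.sub_prox_mem_subdifferential [CompleteSpace H] (hf : IsGamma0 f) {w u : H}
    (hu : u ∈ subdifferential f w) (x : H) : x - prox f x ∈ subdifferential f (prox f x) := by
  have hgrad : ∀ p, HasGradientAt (fun y : H => 1 / 2 * ‖x - y‖ ^ 2) (-(x - p)) p := fun p => by
    rw [hasGradientAt_iff_hasFDerivAt]
    have h1 : HasFDerivAt (fun y : H => x - y) (-ContinuousLinearMap.id ℝ H) p :=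
      (hasFDerivAt_id p).const_sub x
    have h2 := h1.norm_sq.const_mul (1 / 2)
    have h3 : InnerProductSpace.toDual ℝ H (-(x - p)) =
        (1 / 2 : ℝ) • 2 • (innerSL ℝ (x - p)).comp (-ContinuousLinearMap.id ℝ H) := by
      ext v
      simp [-neg_sub]
    rw [h3]
    exact h2
  have hconv : ConvexOn ℝ Set.univ (fun y : H => 1 / 2 * ‖x - y‖ ^ 2) := by
    have h1 : ConvexOn ℝ Set.univ (fun y : H => ‖y‖ ^ 2) :=
      (convexOn_univ_norm (E := H)).pow (fun _ _ => norm_nonneg _) 2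
    have h2 := (h1.comp_affineMap (AffineMap.const ℝ H x - AffineMap.id ℝ H)).smul
      (by norm_num : (0 : ℝ) ≤ 1 / 2)
    simpa using h2
  have hex : ∃ p, IsMinOn (fun y : H => f y + ((1 / 2 * ‖x - y‖ ^ 2 : ℝ) : EReal)) Set.univ p := by
    refine hf.exists_isMinOn (by fun_prop) hconv fun c => ?_
    have h1 := hf.ne_top_of_mem_subdifferential hu
    obtain ⟨a, ha⟩ : ∃ a : ℝ, f w = a := ⟨_, (EReal.coe_toReal h1 (hf.ne_bot w)).symm⟩
    -- The subgradient `u` gives an affine minorant of f. With t = ‖x - z‖, the bound then follows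
    -- from t²/2 - ‖u‖t ≥ t - ‖u‖² - 1.
    refine ⟨c + ‖w‖ * ‖u‖ - a + ‖x‖ * ‖u‖ + ‖u‖ ^ 2 + 1 + ‖x‖, fun z hz => ?_⟩
    rw [EReal.add_coe_le_coe_iff] at hz
    have h2 := (hu z).trans hz
    rw [ha] at h2
    norm_cast at h2
    have h3 : inner ℝ (z - w) u = inner ℝ x u - inner ℝ (x - z) u - inner ℝ w u := by
      simp only [inner_sub_left]; ring
    have h4 := (abs_le.1 (abs_real_inner_le_norm x u)).1
    have h5 := real_inner_le_norm (x - z) u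
    have h6 := real_inner_le_norm w u
    have h7 : ‖z‖ ≤ ‖x - z‖ + ‖x‖ := by
      rw [norm_sub_rev]; simpa using norm_add_le (z - x) x
    nlinarith [sq_nonneg (‖x - z‖ - ‖u‖ - 1), sq_nonneg (‖u‖ - 1), norm_nonneg u]
  have hmin := Classical.epsilon_spec hex
  have hmem := hf.neg_gradient_mem_subdifferential (hgrad _) hmin
  rwa [neg_neg] at hmem

end Minimizers

/-! ### Energy estimate and asymptotics of the iteration -/

section Algorithm

variable {H : Type*} [NormedAddCommGroup H] [InnerProductSpace ℝ H]

lemma IsGamma0.smul_mem_subdifferential_iff {f : H → EReal} (hf : IsGamma0 f) {c : ℝ} (hc : 0 < c)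
    {u w : H} :
    c • u ∈ subdifferential (fun z => (c : EReal) * f z) w ↔ u ∈ subdifferential f w := by
  refine forall_congr' fun y => ?_
  have h1 := hf.ne_bot w
  have h2 := hf.ne_bot y
  rw [inner_smul_right]
  generalize inner ℝ (y - w) u = t
  dsimp only
  generalize f w = a at h1 ⊢
  generalize f y = b at h2 ⊢
  induction b with
  | bot => exact absurd rfl h2
  | top => simp [EReal.coe_mul_top_of_pos hc]
  | coe b =>
    induction a with
    | bot => exact absurd rfl h1
    | top =>
      rw [EReal.coe_mul_top_of_pos hc, EReal.coe_add_top, EReal.coe_add_top, ← EReal.coe_mul]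
      simp only [top_le_iff, EReal.coe_ne_top]
    | coe a =>
      norm_cast
      rw [← mul_add, mul_le_mul_iff_right₀ hc]

/-- The one-step energy estimate for the reflected forward-backward iteration. -/
lemma reflected_step_estimate {μ γ : ℝ} (hμ : 0 < μ) (hγ : 0 < γ) {b d e z : H}
    (hmono : 0 ≤ inner ℝ (-e - γ • b) (z + e)) (hcoc : ‖b‖ ^ 2 ≤ μ * inner ℝ b (z + d)) :
    ‖z + e‖ ^ 2 + γ * μ * ‖e‖ ^ 2 + (1 - 2 * (γ * μ)) * ‖e‖ ^ 2 ≤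
      ‖z‖ ^ 2 + γ * μ * ‖d‖ ^ 2 := by
  -- The claim is h1 + h2 + h3 + 2·h4. The two squares absorb ⟨b, e - d⟩ and cancel ⟨e, d⟩, while
  -- `h3` (cocoercivity) cancels ‖b‖².
  have h1 : 0 ≤ 2 * γ / μ * ‖b‖ ^ 2 + 2 * γ * (inner ℝ b e - inner ℝ b d) +
      γ * μ / 2 * (‖e‖ ^ 2 - 2 * inner ℝ e d + ‖d‖ ^ 2) := by
    have h : 0 ≤ γ / (2 * μ) * ‖(2 : ℝ) • b + μ • (e - d)‖ ^ 2 := by positivity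
    rw [norm_add_sq_real, norm_smul, norm_smul, mul_pow, mul_pow, norm_sub_sq_real,
      inner_smul_left, inner_smul_right, inner_sub_right, Real.norm_eq_abs, Real.norm_eq_abs,
      sq_abs, sq_abs, conj_trivial] at h
    refine h.trans_eq ?_
    field_simp
  have h2 : 0 ≤ γ * μ / 2 * (‖e‖ ^ 2 + 2 * inner ℝ e d + ‖d‖ ^ 2) := by
    rw [← norm_add_sq_real]
    positivity
  have h3 : 0 ≤ 2 * γ * (inner ℝ b z + inner ℝ b d) - 2 * γ / μ * ‖b‖ ^ 2 := by
    rw [inner_add_right] at hcoc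
    have h := mul_nonneg (by positivity : 0 ≤ 2 * γ / μ) (sub_nonneg.2 hcoc)
    refine h.trans_eq ?_
    field_simp
  have h4 : 0 ≤ -inner ℝ z e - ‖e‖ ^ 2 - γ * (inner ℝ b z + inner ℝ b e) := by
    rw [inner_sub_left, inner_neg_left, inner_smul_left, inner_add_right, inner_add_right,
      real_inner_self_eq_norm_sq, real_inner_comm, conj_trivial] at hmono
    linarith
  rw [norm_add_sq_real]
  linarith

/-- The residuals of the forward-backward steps tend to zero with the increments. -/
lemma tendsto_residual {B : H → H} {μ : ℝ≥0} (hB : LipschitzWith μ B) (γ : ℝ) {x y : ℕ → H}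
    (hx : Tendsto (fun n => x n - x (n + 1)) atTop (𝓝 0))
    (hy : Tendsto (fun n => x (n + 1) - y n) atTop (𝓝 0)) :
    Tendsto (fun n => γ⁻¹ • (x n - γ • B (y n) - x (n + 1)) + γ⁻¹ • γ • B (x (n + 1))) atTop
      (𝓝 0) := by
  have h1 : Tendsto (fun n => B (x (n + 1)) - B (y n)) atTop (𝓝 0) := by
    refine squeeze_zero_norm (fun n => ?_) (by simpa using hy.norm.const_mul (μ : ℝ))
    simpa [dist_eq_norm] using hB.dist_le_mul (x (n + 1)) (y n)
  have h2 := (hx.const_smul γ⁻¹).add ((h1.const_smul γ).const_smul γ⁻¹)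
  simp only [smul_zero, add_zero] at h2
  refine h2.congr fun n => ?_
  module

variable [CompleteSpace H]

/-- Weak limits of points `x n` at which `f + h` has subgradients tending to zero are minimizers
of `f + h`. -/
lemma isMinOn_of_tendsto_subgradient {f : H → EReal} (hf : IsGamma0 f) {h : H → ℝ}
    (h_convex : ConvexOn ℝ Set.univ h) (h_diff : Differentiable ℝ h) {x u : ℕ → H} {R : ℝ}
    (hR : ∀ n, ‖x n‖ ≤ R) (hu : ∀ n, u n ∈ subdifferential f (x (n + 1)))
    (hlim : Tendsto (fun n => u n + ∇ h (x (n + 1))) atTop (𝓝 0)) {U : Ultrafilter ℕ}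
    (hU : ↑U ≤ (atTop : Filter ℕ)) {p : H}
    (hp : Tendsto (fun n => toWeakSpace ℝ H (x n)) U (𝓝 (toWeakSpace ℝ H p))) :
    IsMinOn (fun z : H => f z + (h z : EReal)) Set.univ p := by
  intro z _
  refine EReal.le_of_forall_lt_iff_le.1 fun c hc => ?_
  refine mem_of_tendsto_toWeakSpace hp (hf.isClosed_sublevel h_diff.continuous c)
    (hf.convex_sublevel h_convex c) (hU ?_)
  obtain ⟨a, ha⟩ : ∃ a : ℝ, f z = a := by
    refine ⟨_, (EReal.coe_toReal (fun htop => ?_) (hf.ne_bot z)).symm⟩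
    simp [htop] at hc
  dsimp only at hc
  rw [ha] at hc
  norm_cast at hc
  have h1 : Tendsto (fun n => a + h z + (‖z‖ + R) * ‖u n + ∇ h (x (n + 1))‖) atTop
      (𝓝 (a + h z)) := by
    simpa using (hlim.norm.const_mul (‖z‖ + R)).const_add (a + h z)
  -- The subgradients live at `x (n + 1)`, hence the shift.
  rw [← map_add_atTop_eq_nat 1]
  show ∀ᶠ n in atTop, f (x (n + 1)) + (h (x (n + 1)) : EReal) ≤ c
  filter_upwards [h1.eventually (gt_mem_nhds hc)] with n hn
  obtain ⟨b, hb⟩ : ∃ b : ℝ, f (x (n + 1)) = b :=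
    ⟨_, (EReal.coe_toReal (hf.ne_top_of_mem_subdifferential (hu n)) (hf.ne_bot _)).symm⟩
  have h2 := hu n z
  rw [ha, hb] at h2
  norm_cast at h2
  rw [hb]
  norm_cast
  have h3 := h_convex.add_inner_gradient_le (h_diff (x (n + 1))).hasGradientAt z
  rw [real_inner_comm] at h3
  have h4 := (abs_le.1 (abs_real_inner_le_norm (z - x (n + 1)) (u n + ∇ h (x (n + 1))))).1
  rw [inner_add_right] at h4
  have h5 : ‖z - x (n + 1)‖ ≤ ‖z‖ + R := (norm_sub_le _ _).trans (by gcongr; exact hR _)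
  have h6 := mul_le_mul_of_nonneg_right h5 (norm_nonneg (u n + ∇ h (x (n + 1))))
  linarith

end Algorithm

end ReflectedFB

/-! ### Convergence of the reflected forward-backward iteration -/

theorem mainTheorem4 {H : Type*} [NormedAddCommGroup H] [InnerProductSpace ℝ H] [CompleteSpace H]
    (f : H → EReal) (hf : ReflectedFB.IsGamma0 f)
    (h : H → ℝ) (h_convex : ConvexOn ℝ Set.univ h) (h_diff : Differentiable ℝ h)
    (μ : ℝ≥0) (hμ : 0 < μ) (h_lip : LipschitzWith μ (∇ h))
    (h_zer : (ReflectedFB.zer fun z : H => ReflectedFB.subdifferential f z + {∇ h z}).Nonempty)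
    (γ : ℝ) (hγ : γ ∈ Set.Ioo (0 : ℝ) (0.5 / (μ : ℝ)))
    -- `xneg` is the starting point with index `-1`, and `x 0` the one with index `0`
    (xneg : H) (x y : ℕ → H)
    (hy_zero : y 0 = (2 : ℝ) • x 0 - xneg)
    (hy_succ : ∀ n : ℕ, y (n + 1) = (2 : ℝ) • x (n + 1) - x n)
    (hx : ∀ n : ℕ, x (n + 1) =
      ReflectedFB.prox (fun z : H => (γ : EReal) * f z) (x n - γ • ∇ h (y n))) :
    ∃ xbar : H,
      Tendsto (fun n : ℕ => toWeakSpace ℝ H (x n)) atTop (𝓝 (toWeakSpace ℝ H xbar)) ∧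
      xbar ∈ (ReflectedFB.zer fun z : H => ReflectedFB.subdifferential f z + {∇ h z}) ∧
      IsMinOn (fun z : H => f z + (h z : EReal)) Set.univ xbar := by
  have hγ0 : 0 < γ := hγ.1
  have hμ' : (0 : ℝ) < μ := hμ
  have hγμ : 0 < 1 - 2 * (γ * μ) := by
    have := (lt_div_iff₀ hμ').1 hγ.2
    linarith
  obtain ⟨s₀, hs₀⟩ := h_zer
  -- `d n` is the increment `x n - x (n - 1)`
  obtain ⟨d, hd_succ, hyd⟩ : ∃ d : ℕ → H, (∀ n, d (n + 1) = x (n + 1) - x n) ∧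
      ∀ n, y n = x n + d n := by
    refine ⟨fun n => y n - x n, fun n => ?_, fun n => (add_sub_cancel _ _).symm⟩
    simp only [hy_succ]
    module
  have hres : ∀ n, γ⁻¹ • (x n - γ • ∇ h (y n) - x (n + 1)) ∈
      ReflectedFB.subdifferential f (x (n + 1)) := fun n => by
    rw [← hf.smul_mem_subdifferential_iff hγ0, smul_inv_smul₀ hγ0.ne', hx n]
    -- The zero `s₀` supplies the subgradient that makes the proximal problem coercive.
    exact (hf.const_mul hγ0).sub_prox_mem_subdifferential
      ((hf.smul_mem_subdifferential_iff hγ0).2 (ReflectedFB.mem_zer_add_singleton.1 hs₀)) _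
  have hstep : ∀ s ∈ ReflectedFB.zer fun z : H => ReflectedFB.subdifferential f z + {∇ h z},
      ∀ n, ‖x (n + 1) - s‖ ^ 2 + γ * μ * ‖d (n + 1)‖ ^ 2 + (1 - 2 * (γ * μ)) * ‖d (n + 1)‖ ^ 2 ≤
        ‖x n - s‖ ^ 2 + γ * μ * ‖d n‖ ^ 2 := fun s hs n => by
    have h1 := hf.subdifferential_monotone (hres n) (ReflectedFB.mem_zer_add_singleton.1 hs)
    have h2 := ReflectedFB.cocoercive_gradient h_convex h_diff hμ h_lip (y n) s
    rw [hyd n, add_sub_right_comm] at h2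
    rw [show x (n + 1) - s = (x n - s) + d (n + 1) by rw [hd_succ]; abel] at h1 ⊢
    refine ReflectedFB.reflected_step_estimate hμ' hγ0 ?_ h2
    have h3 := mul_nonneg hγ0.le h1
    rw [← real_inner_smul_left] at h3
    refine h3.trans_eq (congrArg (inner ℝ · (x n - s + d (n + 1))) ?_)
    rw [smul_sub, smul_inv_smul₀ hγ0.ne', hyd n, hd_succ]
    module
  have hanti : ∀ s ∈ ReflectedFB.zer fun z : H => ReflectedFB.subdifferential f z + {∇ h z},
      Antitone fun n => ‖x n - s‖ ^ 2 + γ * μ * ‖d n‖ ^ 2 := fun s hs =>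
    antitone_nat_of_succ_le fun n => by
      have := hstep s hs n
      have h1 := mul_nonneg hγμ.le (sq_nonneg ‖d (n + 1)‖)
      linarith
  have hconv : ∀ s ∈ ReflectedFB.zer fun z : H => ReflectedFB.subdifferential f z + {∇ h z},
      ∃ c, Tendsto (fun n => ‖x n - s‖ ^ 2 + γ * μ * ‖d n‖ ^ 2) atTop (𝓝 c) := fun s hs =>
    ⟨_, tendsto_atTop_ciInf (hanti s hs) ⟨0, by rintro _ ⟨n, rfl⟩; positivity⟩⟩
  -- Consecutive energies have the same limit, and their difference dominates (1 - 2γμ)‖d_{n+1}‖².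
  have hd : Tendsto d atTop (𝓝 0) := by
    obtain ⟨c, hc⟩ := hconv s₀ hs₀
    have h1 := (hc.sub ((tendsto_add_atTop_iff_nat 1).2 hc)).div_const (1 - 2 * (γ * μ))
    rw [sub_self, zero_div] at h1
    have h2 : Tendsto (fun n => ‖d (n + 1)‖ ^ 2) atTop (𝓝 0) := by
      refine squeeze_zero (fun n => by positivity) (fun n => ?_) h1
      rw [le_div_iff₀ hγμ]
      linarith [hstep s₀ hs₀ n]
    rw [tendsto_zero_iff_norm_tendsto_zero, ← tendsto_add_atTop_iff_nat 1]
    simpa [Real.sqrt_sq] using h2.sqrt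
  have hR : ∀ n, ‖x n‖ ≤ ‖x 0 - s₀‖ ^ 2 + γ * μ * ‖d 0‖ ^ 2 + 1 + ‖s₀‖ := fun n => by
    have h1 := hanti s₀ hs₀ (Nat.zero_le n)
    have h2 : ‖x n‖ ≤ ‖x n - s₀‖ + ‖s₀‖ := by simpa using norm_add_le (x n - s₀) s₀
    have h3 : 0 ≤ γ * μ * ‖d n‖ ^ 2 := by positivity
    dsimp only at h1
    nlinarith [sq_nonneg (‖x n - s₀‖ - 1)]
  have hd' := (tendsto_add_atTop_iff_nat 1).2 hd
  have hlim : Tendsto (fun n => γ⁻¹ • (x n - γ • ∇ h (y n) - x (n + 1)) + ∇ h (x (n + 1))) atTop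
      (𝓝 0) := by
    have h1 := ReflectedFB.tendsto_residual h_lip γ (x := x) (y := y)
      (by simpa [hd_succ] using hd'.neg) (by
        have := hd'.sub hd
        rw [sub_zero] at this
        refine this.congr fun n => ?_
        rw [hd_succ, hyd]
        abel)
    simpa only [inv_smul_smul₀ hγ0.ne'] using h1
  have hmin : ∀ U : Ultrafilter ℕ, ↑U ≤ (atTop : Filter ℕ) → ∀ p : H,
      Tendsto (fun n => toWeakSpace ℝ H (x n)) U (𝓝 (toWeakSpace ℝ H p)) →
      IsMinOn (fun z : H => f z + (h z : EReal)) Set.univ p := fun U hU p hp =>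
    ReflectedFB.isMinOn_of_tendsto_subgradient hf h_convex h_diff hR hres hlim hU hp
  obtain ⟨p, hpS, hp⟩ := ReflectedFB.exists_tendsto_toWeakSpace_of_opial ⟨s₀, hs₀⟩
    (fun s hs => by
      obtain ⟨c, hc⟩ := hconv s hs
      have h1 := hc.sub ((hd.norm.pow 2).const_mul (γ * μ))
      exact ⟨_, h1.congr fun n => by ring⟩)
    (fun U hU p hp => ReflectedFB.mem_zer_add_singleton.2 <|
      hf.neg_gradient_mem_subdifferential (h_diff p).hasGradientAt (hmin U hU p hp))
  obtain ⟨U, hU⟩ := Ultrafilter.exists_le (atTop : Filter ℕ)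
  exact ⟨p, hp, hpS, hmin U hU p (hp.mono_left hU)⟩
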